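/- Let $n\ge 0$, let $\mathbb S^{2n+1}\subset\mathbb C^{n+1}$ be the unit sphere with its standard contact structure $\xi_0=T\mathbb S^{2n+1}\cap i\,(T\mathbb S^{2n+1})$, and let $\mathrm{Cont}(\mathbb S^{2n+1},\xi_0)$ be the group of smooth diffeomorphisms $\varphi$ of $\mathbb S^{2n+1}$ with $\varphi_*\xi_0=\xi_0$, equipped with the $C^\infty$ topology. Unitary linear maps of $\mathbb C^{n+1}$ restrict to contactomorphisms of the sphere, which gives a continuous inclusion $\iota: U(n+1)\to\mathrm{Cont}(\mathbb S^{2n+1},\xi_0)$. Then for every $0\le j\le 2n+1$ the induced map of homotopy groups (based at the identity elements) $$\pi_j(\iota):\pi_j(U(n+1))\longrightarrow\pi_j(\mathrm{Cont}(\mathbb S^{2n+1},\xi_0))$$ is injective. -/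

import Mathlib

open scoped Manifold ContDiff Topology Topology.Homotopy

noncomputable section

namespace ContactSphere

/-! ### The unit sphere in complex space -/

/-- Complex space `ℂ^(n+1)` with its Euclidean norm. -/
abbrev Space (n : ℕ) : Type := EuclideanSpace ℂ (Fin (n + 1))

/-- The unit sphere `S^(2n+1)` in `ℂ^(n+1)`. -/
abbrev Sphere (n : ℕ) : Type := Metric.sphere (0 : Space n) 1

/-- `ℂ^(n+1)` has real dimension `2n+2`; this fact supplies Mathlib's smooth manifold structure
of dimension `2n+1` on the unit sphere. -/
instance finrankSpace (n : ℕ) : Fact (Module.finrank ℝ (Space n) = (2 * n + 1) + 1) :=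
  ⟨by rw [finrank_real_of_complex, finrank_euclideanSpace_fin]; ring⟩

/-- The differential at `z` of the inclusion of the sphere into `ℂ^(n+1)`. -/
def inclDeriv {n : ℕ} (z : Sphere n) : TangentSpace (𝓡 (2 * n + 1)) z →L[ℝ] Space n :=
  mvfderiv (𝓡 (2 * n + 1)) (Subtype.val : Sphere n → Space n) z

/-- Multiplication by `i` on `ℂ^(n+1)`, as a real linear map. -/
def mulI (n : ℕ) : Space n →ₗ[ℝ] Space n where
  toFun v := Complex.I • v
  map_add' := smul_add _
  map_smul' c v := smul_comm Complex.I c v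

/-! ### The standard contact structure and its contactomorphisms -/

/-- The standard contact structure `ξ₀ = T S ∩ i (T S)`, as a distribution of subspaces of the
tangent spaces of the sphere (here `T_z S` is identified with its image in `ℂ^(n+1)`). -/
def contactPlane {n : ℕ} (z : Sphere n) : Submodule ℝ (TangentSpace (𝓡 (2 * n + 1)) z) :=
  ((inclDeriv z).toLinearMap.range ⊓ (inclDeriv z).toLinearMap.range.map (mulI n)).comap
    (inclDeriv z).toLinearMap

/-- A smooth diffeomorphism `φ` of the sphere is a contactomorphism if its differential maps
`ξ₀(z)` onto `ξ₀(φ z)` for all `z`. -/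
def IsContact {n : ℕ}
    (φ : Sphere n ≃ₘ^∞⟮𝓡 (2 * n + 1), 𝓡 (2 * n + 1)⟯ Sphere n) : Prop :=
  ∀ z : Sphere n, (contactPlane z).map
    (mfderiv (𝓡 (2 * n + 1)) (𝓡 (2 * n + 1)) φ z).toLinearMap = contactPlane (φ z)

/-- The contactomorphisms `Cont(S^(2n+1), ξ₀)` of the standard contact sphere. -/
def Cont (n : ℕ) : Type :=
  {φ : Sphere n ≃ₘ^∞⟮𝓡 (2 * n + 1), 𝓡 (2 * n + 1)⟯ Sphere n // IsContact φ}

lemma mem_contactPlane {n : ℕ} {z : Sphere n} {v : TangentSpace (𝓡 (2 * n + 1)) z} :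
    v ∈ contactPlane z ↔ ∃ w, Complex.I • inclDeriv z w = inclDeriv z v := by
  simp [contactPlane, mulI]

lemma mfderiv_trans {n : ℕ}
    (φ ψ : Sphere n ≃ₘ^∞⟮𝓡 (2 * n + 1), 𝓡 (2 * n + 1)⟯ Sphere n) (z : Sphere n) :
    mfderiv (𝓡 (2 * n + 1)) (𝓡 (2 * n + 1)) (φ.trans ψ) z =
      (mfderiv (𝓡 (2 * n + 1)) (𝓡 (2 * n + 1)) ψ (φ z)).comp
        (mfderiv (𝓡 (2 * n + 1)) (𝓡 (2 * n + 1)) φ z) := by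
  rw [Diffeomorph.coe_trans]
  exact mfderiv_comp z (ψ.mdifferentiable (by simp) _) (φ.mdifferentiable (by simp) _)

lemma isContact_refl (n : ℕ) : IsContact (Diffeomorph.refl (𝓡 (2 * n + 1)) (Sphere n) ∞) := by
  intro z
  have : mfderiv (𝓡 (2 * n + 1)) (𝓡 (2 * n + 1))
      (Diffeomorph.refl (𝓡 (2 * n + 1)) (Sphere n) ∞) z = ContinuousLinearMap.id ℝ _ := by
    rw [Diffeomorph.coe_refl]; exact mfderiv_id
  rw [this]
  exact Submodule.map_id _

lemma IsContact.trans {n : ℕ}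
    {φ ψ : Sphere n ≃ₘ^∞⟮𝓡 (2 * n + 1), 𝓡 (2 * n + 1)⟯ Sphere n}
    (hφ : IsContact φ) (hψ : IsContact ψ) : IsContact (φ.trans ψ) := by
  intro z
  rw [mfderiv_trans]
  have := hψ (φ z)
  rw [← hφ z, ← Submodule.map_comp] at this
  exact this

lemma IsContact.symm {n : ℕ}
    {φ : Sphere n ≃ₘ^∞⟮𝓡 (2 * n + 1), 𝓡 (2 * n + 1)⟯ Sphere n}
    (hφ : IsContact φ) : IsContact φ.symm := by
  intro z
  obtain ⟨y, rfl⟩ := φ.surjective z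
  have h := mfderiv_trans φ φ.symm y
  have h2 := isContact_refl n y
  rw [← Diffeomorph.self_trans_symm φ, h] at h2
  change (contactPlane (φ y)).map
    (mfderiv (𝓡 (2 * n + 1)) (𝓡 (2 * n + 1)) φ.symm (φ y)).toLinearMap =
      contactPlane (φ.symm (φ y))
  rw [← hφ y, ← Submodule.map_comp]
  exact h2

/-- Composition makes the contactomorphisms a group. -/
instance (n : ℕ) : Group (Cont n) where
  mul φ ψ := ⟨ψ.1.trans φ.1, ψ.2.trans φ.2⟩
  one := ⟨Diffeomorph.refl _ _ _, isContact_refl n⟩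
  inv φ := ⟨φ.1.symm, φ.2.symm⟩
  mul_assoc _ _ _ := rfl
  one_mul _ := rfl
  mul_one _ := rfl
  inv_mul_cancel φ := Subtype.ext (Diffeomorph.self_trans_symm φ.1)

/-! ### The smooth topology -/

/-- The extension of a self-map `f` of the sphere to `ℂ^(n+1) ∖ {0}` that is constant on rays,
`x ↦ f (x / ‖x‖)` (with value `0` at the origin). -/
def radialExt {n : ℕ} (f : Sphere n → Sphere n) (x : Space n) : Space n :=
  if hx : x = 0 then 0
  else f ⟨(‖x‖⁻¹ : ℝ) • x, by
    rw [mem_sphere_zero_iff_norm, norm_smul, norm_inv, norm_norm,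
      inv_mul_cancel₀ (norm_ne_zero_iff.mpr hx)]⟩

/-- The `k`-th derivative along the sphere of the radial extension of a contactomorphism, as an
element of the space of functions on the sphere with the topology of uniform convergence. -/
def jet {n : ℕ} (k : ℕ) (φ : Cont n) :
    UniformFun (Sphere n) (ContinuousMultilinearMap ℝ (fun _ : Fin k => Space n) (Space n)) :=
  UniformFun.ofFun fun z => iteratedFDeriv ℝ k (radialExt φ.1) z

/-- The `C^∞` topology on the contactomorphism group: uniform convergence of the maps together
with all their derivatives. The derivatives of a self-map `φ` of the (compact) sphere are taken
to be those of the radial extension `x ↦ φ (x / ‖x‖)`, which is smooth on `ℂ^(n+1) ∖ {0}`;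
their uniform convergence on the sphere is uniform convergence of all derivatives of `φ` in
charts. -/
instance (n : ℕ) : TopologicalSpace (Cont n) :=
  ⨅ k : ℕ, TopologicalSpace.induced (jet k) inferInstance

/-! ### The unitary group acting by contactomorphisms -/

/-- A unitary matrix as a linear map of `ℂ^(n+1)`. -/
def unitaryLin {n : ℕ} (A : Matrix.unitaryGroup (Fin (n + 1)) ℂ) : Space n →L[ℂ] Space n :=
  Matrix.toEuclideanCLM (n := Fin (n + 1)) (𝕜 := ℂ) A.1

lemma unitaryLin_mul {n : ℕ} (A B : Matrix.unitaryGroup (Fin (n + 1)) ℂ) (x : Space n) :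
    unitaryLin (A * B) x = unitaryLin A (unitaryLin B x) := by
  simp [unitaryLin]

lemma unitaryLin_one {n : ℕ} (x : Space n) :
    unitaryLin (1 : Matrix.unitaryGroup (Fin (n + 1)) ℂ) x = x := by
  simp [unitaryLin]

lemma norm_unitaryLin {n : ℕ} (A : Matrix.unitaryGroup (Fin (n + 1)) ℂ) (x : Space n) :
    ‖unitaryLin A x‖ = ‖x‖ := by
  have h : ContinuousLinearMap.adjoint (unitaryLin A) ∘L unitaryLin A =
      ContinuousLinearMap.id ℂ _ := by
    rw [← ContinuousLinearMap.star_eq_adjoint]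
    change star (unitaryLin A) * unitaryLin A = 1
    unfold unitaryLin
    rw [← map_star, ← map_mul, Matrix.UnitaryGroup.star_mul_self, map_one]
  exact (ContinuousLinearMap.norm_map_iff_adjoint_comp_self _).mpr h x

/-- The action of a unitary matrix on the sphere. -/
def unitarySphere {n : ℕ} (A : Matrix.unitaryGroup (Fin (n + 1)) ℂ) (z : Sphere n) : Sphere n :=
  ⟨unitaryLin A z, by
    rw [mem_sphere_zero_iff_norm, norm_unitaryLin]; exact mem_sphere_zero_iff_norm.mp z.2⟩

lemma contMDiff_unitarySphere {n : ℕ} (A : Matrix.unitaryGroup (Fin (n + 1)) ℂ) :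
    ContMDiff (𝓡 (2 * n + 1)) (𝓡 (2 * n + 1)) ∞ (unitarySphere A) := by
  have h : ContMDiff (𝓡 (2 * n + 1)) 𝓘(ℝ, Space n) ∞
      (fun z : Sphere n => unitaryLin A (z : Space n)) :=
    (((unitaryLin A).restrictScalars ℝ).contDiff.contMDiff).comp contMDiff_coe_sphere
  exact h.codRestrict_sphere fun z => (unitarySphere A z).2

/-- The action of a unitary matrix on the sphere as a diffeomorphism. -/
def unitaryDiffeo {n : ℕ} (A : Matrix.unitaryGroup (Fin (n + 1)) ℂ) :
    Sphere n ≃ₘ^∞⟮𝓡 (2 * n + 1), 𝓡 (2 * n + 1)⟯ Sphere n where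
  toFun := unitarySphere A
  invFun := unitarySphere A⁻¹
  left_inv z := Subtype.ext <| by
    change unitaryLin A⁻¹ (unitaryLin A z) = z
    rw [← unitaryLin_mul, inv_mul_cancel, unitaryLin_one]
  right_inv z := Subtype.ext <| by
    change unitaryLin A (unitaryLin A⁻¹ z) = z
    rw [← unitaryLin_mul, mul_inv_cancel, unitaryLin_one]
  contMDiff_toFun := contMDiff_unitarySphere A
  contMDiff_invFun := contMDiff_unitarySphere A⁻¹

lemma inclDeriv_unitary {n : ℕ} (A : Matrix.unitaryGroup (Fin (n + 1)) ℂ) (z : Sphere n)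
    (v : TangentSpace (𝓡 (2 * n + 1)) z) :
    inclDeriv (unitaryDiffeo A z)
      (mfderiv (𝓡 (2 * n + 1)) (𝓡 (2 * n + 1)) (unitaryDiffeo A) z v) =
      unitaryLin A (inclDeriv z v) := by
  have hc : ∀ y : Sphere n, MDifferentiableAt (𝓡 (2 * n + 1)) 𝓘(ℝ, Space n)
      (Subtype.val : Sphere n → Space n) y := fun y =>
    (contMDiff_coe_sphere (m := 1) y).mdifferentiableAt one_ne_zero
  have hL : MDifferentiableAt 𝓘(ℝ, Space n) 𝓘(ℝ, Space n)
      ((unitaryLin A).restrictScalars ℝ) (z : Space n) :=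
    ((unitaryLin A).restrictScalars ℝ).differentiableAt.mdifferentiableAt
  have h1 := mfderiv_comp z (hc (unitaryDiffeo A z))
    ((unitaryDiffeo A).mdifferentiable (by simp) z)
  have h2 := mfderiv_comp z hL (hc z)
  have h3 : (Subtype.val : Sphere n → Space n) ∘ unitaryDiffeo A =
      (unitaryLin A).restrictScalars ℝ ∘ Subtype.val := rfl
  rw [h3, h2] at h1
  have h4 := congrArg (fun L => L v) h1
  rw [mfderiv_eq_fderiv, ContinuousLinearMap.fderiv] at h4
  exact h4.symm

lemma map_contactPlane_le {n : ℕ} (A : Matrix.unitaryGroup (Fin (n + 1)) ℂ) (z : Sphere n)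
    (v : TangentSpace (𝓡 (2 * n + 1)) z) (hv : v ∈ contactPlane z) :
    mfderiv (𝓡 (2 * n + 1)) (𝓡 (2 * n + 1)) (unitaryDiffeo A) z v ∈
      contactPlane (unitaryDiffeo A z) := by
  obtain ⟨w, hw⟩ := mem_contactPlane.mp hv
  refine mem_contactPlane.mpr
    ⟨mfderiv (𝓡 (2 * n + 1)) (𝓡 (2 * n + 1)) (unitaryDiffeo A) z w, ?_⟩
  rw [inclDeriv_unitary, inclDeriv_unitary, ← hw, map_smul]

lemma isContact_unitaryDiffeo {n : ℕ} (A : Matrix.unitaryGroup (Fin (n + 1)) ℂ) :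
    IsContact (unitaryDiffeo A) := by
  intro z
  apply le_antisymm
  · rintro _ ⟨v, hv, rfl⟩
    exact map_contactPlane_le A z v hv
  · intro v hv
    have h := map_contactPlane_le A⁻¹ (unitaryDiffeo A z) v hv
    have hz : unitaryDiffeo A⁻¹ (unitaryDiffeo A z) = z := (unitaryDiffeo A).left_inv z
    have hd := mfderiv_trans (unitaryDiffeo A⁻¹) (unitaryDiffeo A) (unitaryDiffeo A z)
    have he : (unitaryDiffeo A⁻¹).trans (unitaryDiffeo A) = Diffeomorph.refl _ _ _ :=
      Diffeomorph.ext (unitaryDiffeo A).right_inv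
    rw [he, Diffeomorph.coe_refl] at hd
    have hd' := congrArg (fun L => L v) (mfderiv_id.symm.trans hd)
    rw [hz] at h
    have hd'' : v = mfderiv (𝓡 (2 * n + 1)) (𝓡 (2 * n + 1)) (unitaryDiffeo A)
      (unitaryDiffeo A⁻¹ (unitaryDiffeo A z)) (mfderiv (𝓡 (2 * n + 1)) (𝓡 (2 * n + 1))
        (unitaryDiffeo A⁻¹) (unitaryDiffeo A z) v) := hd'
    rw [hz] at hd''
    exact ⟨_, h, hd''.symm⟩

/-- The inclusion `ι : U(n+1) → Cont(S^(2n+1), ξ₀)`, a homomorphism of groups. -/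
def inclusion (n : ℕ) : Matrix.unitaryGroup (Fin (n + 1)) ℂ →* Cont n where
  toFun A := ⟨unitaryDiffeo A, isContact_unitaryDiffeo A⟩
  map_one' := Subtype.ext <| Diffeomorph.ext fun _ => Subtype.ext <| unitaryLin_one _
  map_mul' A B := Subtype.ext <| Diffeomorph.ext fun _ => Subtype.ext <| unitaryLin_mul A B _

lemma radialExt_unitary {n : ℕ} (A : Matrix.unitaryGroup (Fin (n + 1)) ℂ) :
    radialExt (inclusion n A).1 =
      (unitaryLin A).restrictScalars ℝ ∘ radialExt (id : Sphere n → Sphere n) := by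
  funext x
  by_cases hx : x = 0
  · simp [radialExt, hx]
  · simp only [radialExt, hx, dif_neg, not_false_eq_true, Function.comp]
    rfl

lemma contDiffAt_radialExt_id {n : ℕ} (z : Sphere n) (k : ℕ∞) :
    ContDiffAt ℝ k (radialExt (id : Sphere n → Sphere n)) z := by
  have hz : (z : Space n) ≠ 0 := ne_zero_of_mem_unit_sphere z
  have h : ContDiffAt ℝ k (fun x : Space n => (‖x‖⁻¹ : ℝ) • x) z :=
    ((contDiffAt_norm ℝ hz).inv (norm_ne_zero_iff.mpr hz)).smul contDiffAt_id
  refine h.congr_of_eventuallyEq ?_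
  filter_upwards [isOpen_ne.mem_nhds hz] with x hx
  simp only [radialExt, id]
  rw [dif_neg hx]

lemma continuous_inclusion (n : ℕ) : Continuous (inclusion n) := by
  refine continuous_iInf_rng.mpr fun k => continuous_induced_rng.mpr ?_
  let D : Sphere n → ContinuousMultilinearMap ℝ (fun _ : Fin k => Space n) (Space n) :=
    fun z => iteratedFDeriv ℝ k (radialExt (id : Sphere n → Sphere n)) z
  have hD : Continuous D := continuous_iff_continuousAt.mpr fun z =>
    ContinuousAt.comp (g := iteratedFDeriv ℝ k (radialExt (id : Sphere n → Sphere n)))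
      ((contDiffAt_radialExt_id z k).continuousAt_iteratedFDeriv le_rfl)
      continuous_subtype_val.continuousAt
  have hL : Continuous fun A : Matrix.unitaryGroup (Fin (n + 1)) ℂ =>
      (unitaryLin A).restrictScalars ℝ := by
    have h0 : Continuous (Matrix.toEuclideanCLM (n := Fin (n + 1)) (𝕜 := ℂ)) :=
      LinearMap.continuous_of_finiteDimensional
        (Matrix.toEuclideanCLM (n := Fin (n + 1)) (𝕜 := ℂ)).toAlgEquiv.toLinearMap
    exact (ContinuousLinearMap.restrictScalarsL ℂ (Space n) (Space n) ℝ ℝ).continuous.comp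
      (h0.comp continuous_subtype_val)
  have hF : Continuous fun p : Matrix.unitaryGroup (Fin (n + 1)) ℂ × Sphere n =>
      ((unitaryLin p.1).restrictScalars ℝ).compContinuousMultilinearMap (D p.2) :=
    (ContinuousLinearMap.compContinuousMultilinearMapL ℝ (fun _ : Fin k => Space n)
      (Space n) (Space n)).continuous₂.comp
        ((hL.comp continuous_fst).prodMk (hD.comp continuous_snd))
  refine continuous_iff_continuousAt.mpr fun A => ?_
  have hc := (ContinuousMap.curry ⟨_, hF⟩).continuous.tendsto A
  rw [ContinuousMap.tendsto_iff_tendstoUniformly] at hc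
  refine UniformFun.tendsto_iff_tendstoUniformly.mpr ?_
  have hjet : ∀ B : Matrix.unitaryGroup (Fin (n + 1)) ℂ,
      UniformFun.toFun (jet k (inclusion n B)) = fun z =>
        ((unitaryLin B).restrictScalars ℝ).compContinuousMultilinearMap (D z) := by
    intro B
    funext z
    change iteratedFDeriv ℝ k (radialExt (inclusion n B).1) z = _
    rw [radialExt_unitary]
    exact ContinuousLinearMap.iteratedFDeriv_comp_left _ (contDiffAt_radialExt_id z k) le_rfl
  have hjet' : (fun B => UniformFun.toFun (jet k (inclusion n B))) = fun B z =>
        ((unitaryLin B).restrictScalars ℝ).compContinuousMultilinearMap (D z) := funext hjet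
  change TendstoUniformly (fun B => UniformFun.toFun (jet k (inclusion n B)))
    (UniformFun.toFun (jet k (inclusion n A))) _
  rw [hjet', hjet]
  exact hc

/-! ### Induced maps on homotopy groups -/

/-- The map induced on the `j`-th homotopy groups (the set of path components if `j = 0`) by a
continuous based map. -/
def homotopyMap {X Y : Type*} [TopologicalSpace X] [TopologicalSpace Y] (j : ℕ) (f : C(X, Y))
    (x : X) (y : Y) (h : f x = y) : (π_ j X x) → (π_ j Y y) :=
  Quotient.map
    (fun γ : GenLoop (Fin j) X x =>
      (⟨f.comp γ.1, fun t ht => (congrArg f (γ.2 t ht)).trans h⟩ : GenLoop (Fin j) Y y))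
    (fun _ _ H => ContinuousMap.HomotopicRel.comp_continuousMap H f)

end ContactSphere

end

/-!
The inclusion `ι : U(n+1) → Cont(S^(2n+1), ξ₀)` has a continuous left inverse, `unitaryFrame`, so
it is injective on every homotopy group.

The idea is that `U(n+1)` is the bundle of unitary frames of `ξ₀`: a unitary matrix `A` is
determined by the image `A z` of the base point `z` and by its differential on the contact
hyperplane `ξ₀(z)`. For a contactomorphism `φ` the differential at `z` maps `ξ₀(z)`, the complex
orthogonal complement of `z`, onto `ξ₀(φ z)`. If `φ` pulls the contact form `α` back to `f α`, it
pulls `dα` restricted to `ξ₀` back to `f dα` (`symplectic_form_fderiv`), so on `ξ₀` the differential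
is conformally symplectic. When `f z > 0` the complex linear part of such a map is invertible, since
`dα(v, i v) > 0` for `v ≠ 0` (`frameMap_injective`). Together with `z ↦ φ z` this gives an
invertible complex matrix, depending continuously on `φ` in the `C^1` topology and equal to `A` if
`φ` is the action of `A`; the Gram-Schmidt process retracts it to `U(n+1)`. As `f z` never vanishes
(`conformalFactor_ne_zero`), the contactomorphisms with `f z < 0` form a clopen set disjoint from
the image of `ι`, on which the left inverse is taken to be constant.

All derivatives are computed in `ℂ^(n+1)` from the radial extension `x ↦ φ (x / ‖x‖)`, the one that
defines the topology. The form `α` at `x` is `⟪i x, ·⟫`, in terms of the real inner product.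
-/

noncomputable section

namespace ContactSphere

open Complex

/-! ### Continuity of the Gram-Schmidt process -/

section GramSchmidt

open InnerProductSpace

variable {𝕜 E ι X : Type*} [RCLike 𝕜] [NormedAddCommGroup E] [InnerProductSpace 𝕜 E]
  [LinearOrder ι] [LocallyFiniteOrderBot ι] [WellFoundedLT ι] [TopologicalSpace X]

lemma continuous_gramSchmidt {f : X → ι → E} (hf : ∀ i, Continuous fun x => f x i)
    (hli : ∀ x, LinearIndependent 𝕜 (f x)) (i : ι) :
    Continuous fun x => gramSchmidt 𝕜 (f x) i := by
  induction i using WellFoundedLT.induction with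
  | ind i ih =>
    simp only [gramSchmidt_def 𝕜 _ i, Submodule.starProjection_singleton]
    refine (hf i).sub (continuous_finsetSum _ fun k hk => ?_)
    have hk' := ih k (Finset.mem_Iio.mp hk)
    refine ((hk'.inner (hf i)).div ?_ fun x => ?_).smul hk'
    · exact RCLike.continuous_ofReal.comp (hk'.norm.pow 2)
    · simpa using gramSchmidt_ne_zero k (hli x)

lemma continuous_gramSchmidtNormed {f : X → ι → E} (hf : ∀ i, Continuous fun x => f x i)
    (hli : ∀ x, LinearIndependent 𝕜 (f x)) (i : ι) :
    Continuous fun x => gramSchmidtNormed 𝕜 (f x) i := by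
  have h := continuous_gramSchmidt hf hli i
  refine Continuous.smul ?_ h
  refine (RCLike.continuous_ofReal.comp h.norm).inv₀ fun x => ?_
  simpa using gramSchmidt_ne_zero i (hli x)

lemma gramSchmidtNormed_of_orthonormal {f : ι → E} (hf : Orthonormal 𝕜 f) :
    gramSchmidtNormed 𝕜 f = f := by
  funext i
  rw [gramSchmidtNormed, gramSchmidt_of_orthogonal 𝕜 hf.2, hf.1 i]
  simp

end GramSchmidt

/-! ### The conformal factor of a map preserving the contact form up to scale -/

section Conformal

variable {n : ℕ}

local notation "⟪" x ", " y "⟫" => inner ℝ x y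

/-- The real inner product on `ℂ^(n+1)` is the one of the product of copies of `ℂ = ℝ²`. -/
lemma real_inner_eq_re (x y : Space n) : ⟪x, y⟫ = (inner ℂ x y).re := by
  simp [PiLp.inner_apply, Complex.inner, mul_comm]

lemma real_inner_I_smul_I_smul (x y : Space n) : ⟪I • x, I • y⟫ = ⟪x, y⟫ := by
  simp [real_inner_eq_re, ← mul_assoc]

lemma real_inner_I_smul_left (x y : Space n) : ⟪I • x, y⟫ = -⟪x, I • y⟫ := by
  simp [real_inner_eq_re]

lemma real_inner_I_smul_self (x : Space n) : ⟪I • x, x⟫ = 0 := by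
  have h := real_inner_I_smul_left x x
  rw [real_inner_comm (I • x) x] at h
  linarith

/-- If `F` pulls the form `α_x = ⟪i x, ·⟫` back to a multiple of itself near `z`, then on the
contact hyperplane at `z` it pulls `dα = 2 ⟪i ·, ·⟫` back to the same multiple of itself. The
hypothesis is differentiated at `z`; the second derivative of `F` drops out on
antisymmetrization. -/
lemma conformal_symplectic {F : Space n → Space n} {z : Space n} (hF : ContDiffAt ℝ 2 F z)
    (hz : ‖z‖ = 1)
    (hα : ∀ᶠ x in 𝓝 z, ∀ w, ‖x‖ ^ 2 * ⟪I • F x, fderiv ℝ F x w⟫ =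
      ⟪I • F x, fderiv ℝ F x (I • x)⟫ * ⟪I • x, w⟫)
    {v w : Space n} (hv : ⟪z, v⟫ = 0) (hv' : ⟪I • z, v⟫ = 0) (hw : ⟪z, w⟫ = 0)
    (hw' : ⟪I • z, w⟫ = 0) :
    ⟪I • fderiv ℝ F z v, fderiv ℝ F z w⟫ =
      ⟪I • F z, fderiv ℝ F z (I • z)⟫ * ⟪I • v, w⟫ := by
  set J : Space n →L[ℝ] Space n :=
    ((I : ℂ) • ContinuousLinearMap.id ℂ (Space n)).restrictScalars ℝ with hJ
  have hJa : ∀ x, J x = I • x := fun x => by simp [hJ]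
  have hJr : ∀ x : Space n, I • x = J x := fun x => (hJa x).symm
  simp only [hJr] at hα hv' hw' ⊢
  have hsym : ∀ a b, fderiv ℝ (fderiv ℝ F) z a b = fderiv ℝ (fderiv ℝ F) z b a :=
    fun a b => (hF.isSymmSndFDerivAt (by simp)).eq a b
  have hF1 : HasFDerivAt F (fderiv ℝ F z) z := (hF.differentiableAt (by simp)).hasFDerivAt
  have hF2 : HasFDerivAt (fderiv ℝ F) (fderiv ℝ (fderiv ℝ F) z) z :=
    ((hF.fderiv_right (m := 1) (by norm_num)).differentiableAt (by simp)).hasFDerivAt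
  have hJF : HasFDerivAt (fun x => J (F x)) (J ∘L fderiv ℝ F z) z := J.hasFDerivAt.comp z hF1
  have key : ∀ a b : Space n, ⟪z, a⟫ = 0 → ⟪J z, b⟫ = 0 →
      ⟪J (F z), fderiv ℝ (fderiv ℝ F) z a b⟫ + ⟪J (fderiv ℝ F z a), fderiv ℝ F z b⟫ =
        ⟪J (F z), fderiv ℝ F z (J z)⟫ * ⟪J a, b⟫ := by
    intro a b ha hb
    have h1 : HasFDerivAt (fun x => ⟪J (F x), fderiv ℝ F x b⟫) _ z :=
      hJF.inner ℝ (hF2.clm_apply (hasFDerivAt_const b z))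
    have h2 : HasFDerivAt (fun x => ⟪J (F x), fderiv ℝ F x (J x)⟫) _ z :=
      hJF.inner ℝ (hF2.clm_apply J.hasFDerivAt)
    have h3 : HasFDerivAt (fun x => ⟪J x, b⟫) _ z :=
      J.hasFDerivAt.inner ℝ (hasFDerivAt_const b z)
    have h4 : HasFDerivAt (fun x : Space n => ‖x‖ ^ 2) _ z := (hasFDerivAt_id z).norm_sq
    have h5 := ((h4.mul h1).congr_of_eventuallyEq
      (f₁ := fun x => ⟪J (F x), fderiv ℝ F x (J x)⟫ * ⟪J x, b⟫)
      (hα.mono fun x hx => (hx b).symm)).unique (h2.mul h3)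
    have h6 := congrArg (fun L => L a) h5
    simpa [hz, ha, hb] using h6
  have k1 := key v w hv hw'
  have k2 := key w v hw hv'
  rw [hsym w v] at k2
  have s1 : ⟪J w, v⟫ = -⟪J v, w⟫ := by
    rw [hJa, hJa, real_inner_I_smul_left, real_inner_comm]
  have s2 : ⟪J (fderiv ℝ F z w), fderiv ℝ F z v⟫ = -⟪J (fderiv ℝ F z v), fderiv ℝ F z w⟫ := by
    rw [hJa, hJa, real_inner_I_smul_left, real_inner_comm]
  rw [s1, s2] at k2
  linarith

end Conformal

/-! ### The radial extension of a contactomorphism -/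

section RadialExt

variable {n : ℕ}

local notation "⟪" x ", " y "⟫" => inner ℝ x y

lemma radialExt_coe (f : Sphere n → Sphere n) (z : Sphere n) : radialExt f (z : Space n) = f z := by
  have hz : (z : Space n) ≠ 0 := ne_zero_of_mem_unit_sphere z
  have hn : ‖(z : Space n)‖ = 1 := mem_sphere_zero_iff_norm.mp z.2
  rw [radialExt, dif_neg hz]
  congr 2
  exact Subtype.ext (by simp [hn])

lemma radialExt_smul (f : Sphere n → Sphere n) {c : ℝ} (hc : 0 < c) (x : Space n) :
    radialExt f (c • x) = radialExt f x := by
  by_cases hx : x = 0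
  · simp [hx]
  · rw [radialExt, radialExt, dif_neg hx, dif_neg (smul_ne_zero hc.ne' hx)]
    congr 2
    refine Subtype.ext ?_
    simp only [norm_smul, Real.norm_of_nonneg hc.le, smul_smul]
    congr 1
    field_simp

lemma contDiffAt_radialExt (φ : Cont n) {x : Space n} (hx : x ≠ 0) :
    ContDiffAt ℝ ∞ (radialExt φ.1) x := by
  let U : TopologicalSpace.Opens (Space n) := ⟨{x | x ≠ 0}, isOpen_ne⟩
  have h1 : ContMDiff 𝓘(ℝ, Space n) 𝓘(ℝ, Space n) ∞
      (fun y : U => (‖(y : Space n)‖⁻¹ : ℝ) • (y : Space n)) := by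
    intro y
    have hy : (y : Space n) ≠ 0 := y.2
    have : ContDiffAt ℝ ∞ (fun y : Space n => (‖y‖⁻¹ : ℝ) • y) y :=
      ((contDiffAt_norm ℝ hy).inv (norm_ne_zero_iff.mpr hy)).smul contDiffAt_id
    exact contMDiffAt_subtype_iff.mpr this.contMDiffAt
  have h2 : ∀ y : U, (‖(y : Space n)‖⁻¹ : ℝ) • (y : Space n) ∈ Metric.sphere (0 : Space n) 1 := by
    intro y
    have hy : (y : Space n) ≠ 0 := y.2
    rw [mem_sphere_zero_iff_norm, norm_smul, norm_inv, norm_norm,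
      inv_mul_cancel₀ (norm_ne_zero_iff.mpr hy)]
  have h3 := contMDiff_coe_sphere.comp (φ.1.contMDiff.comp (h1.codRestrict_sphere h2))
  have h4 : ContMDiffAt 𝓘(ℝ, Space n) 𝓘(ℝ, Space n) ∞
      (fun y : U => radialExt φ.1 (y : Space n)) ⟨x, hx⟩ := by
    refine (h3 ⟨x, hx⟩).congr_of_eventuallyEq (Filter.Eventually.of_forall fun y => ?_)
    have hy : (y : Space n) ≠ 0 := y.2
    simp only [radialExt, dif_neg hy]
    rfl
  exact (contMDiffAt_subtype_iff.mp h4).contDiffAt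

/-- The tangent space of the sphere at `z` is the real orthogonal complement of `z`. -/
lemma mem_range_inclDeriv {z : Sphere n} {v : Space n} :
    (∃ w, inclDeriv z w = v) ↔ ⟪(z : Space n), v⟫ = 0 := by
  have h : (inclDeriv z).toLinearMap.range = (ℝ ∙ (z : Space n))ᗮ := range_mvfderiv_subtypeVal z
  rw [← Submodule.mem_orthogonal_singleton_iff_inner_right, ← h]
  rfl

/-- The derivative of the radial extension restricts on the tangent spaces of the sphere to the
differential of the map. -/
lemma fderiv_radialExt_inclDeriv (φ : Cont n) (z : Sphere n)
    (v : TangentSpace (𝓡 (2 * n + 1)) z) :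
    fderiv ℝ (radialExt φ.1) (z : Space n) (inclDeriv z v) =
      inclDeriv (φ.1 z) (mfderiv (𝓡 (2 * n + 1)) (𝓡 (2 * n + 1)) φ.1 z v) := by
  have hc : ∀ y : Sphere n, MDifferentiableAt (𝓡 (2 * n + 1)) 𝓘(ℝ, Space n)
      (Subtype.val : Sphere n → Space n) y := fun y =>
    (contMDiff_coe_sphere (m := 1) y).mdifferentiableAt one_ne_zero
  have hF : MDifferentiableAt 𝓘(ℝ, Space n) 𝓘(ℝ, Space n) (radialExt φ.1) (z : Space n) :=
    ((contDiffAt_radialExt φ (ne_zero_of_mem_unit_sphere z)).differentiableAt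
      (by simp)).mdifferentiableAt
  have h1 := mfderiv_comp z (hc (φ.1 z)) (φ.1.mdifferentiable (by simp) z)
  have h2 := mfderiv_comp z hF (hc z)
  have h3 : (Subtype.val : Sphere n → Space n) ∘ φ.1 = radialExt φ.1 ∘ Subtype.val :=
    funext fun y => (radialExt_coe _ y).symm
  rw [h3, h2] at h1
  have h4 := congrArg (fun L => L v) h1
  rw [mfderiv_eq_fderiv] at h4
  exact h4

/-- The radial extension is constant along rays, so its derivative vanishes in the radial
direction. -/
lemma fderiv_radialExt_self (φ : Cont n) (z : Sphere n) :
    fderiv ℝ (radialExt φ.1) (z : Space n) z = 0 := by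
  have hF : HasFDerivAt (radialExt φ.1) (fderiv ℝ (radialExt φ.1) (z : Space n))
      ((1 : ℝ) • (z : Space n)) := by
    rw [one_smul]
    exact ((contDiffAt_radialExt φ (ne_zero_of_mem_unit_sphere z)).differentiableAt
      (by simp)).hasFDerivAt
  have h1 := hF.comp_hasDerivAt (1 : ℝ) ((hasDerivAt_id (1 : ℝ)).smul_const (z : Space n))
  have h2 : HasDerivAt (fun t : ℝ => radialExt φ.1 (t • (z : Space n))) 0 1 := by
    refine (hasDerivAt_const (1 : ℝ) (radialExt φ.1 (z : Space n))).congr_of_eventuallyEq ?_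
    filter_upwards [lt_mem_nhds one_pos] with t ht
    exact radialExt_smul _ ht _
  simpa using h1.unique h2

lemma inner_fderiv_radialExt (φ : Cont n) (z : Sphere n) (v : Space n) :
    ⟪(φ.1 z : Space n), fderiv ℝ (radialExt φ.1) (z : Space n) v⟫ = 0 := by
  have hn : ⟪(z : Space n), (z : Space n)⟫ = 1 := by
    rw [real_inner_self_eq_norm_sq, mem_sphere_zero_iff_norm.mp z.2]; norm_num
  obtain ⟨w, hw⟩ := mem_range_inclDeriv.mpr
    (show ⟪(z : Space n), v - ⟪(z : Space n), v⟫ • (z : Space n)⟫ = 0 by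
      rw [inner_sub_right, inner_smul_right, hn]; simp)
  have h : fderiv ℝ (radialExt φ.1) (z : Space n) v =
      fderiv ℝ (radialExt φ.1) (z : Space n) (inclDeriv z w) := by
    rw [hw, map_sub, map_smul, fderiv_radialExt_self, smul_zero, sub_zero]
  rw [h, fderiv_radialExt_inclDeriv]
  exact mem_range_inclDeriv.mp ⟨_, rfl⟩

/-- A contactomorphism maps the contact hyperplane at `z`, the complex orthogonal complement of
`z`, to the one at the image point. -/
lemma contact_form_fderiv_eq_zero (φ : Cont n) (z : Sphere n) {v : Space n}
    (hv : ⟪(z : Space n), v⟫ = 0) (hv' : ⟪I • (z : Space n), v⟫ = 0) :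
    ⟪I • (φ.1 z : Space n), fderiv ℝ (radialExt φ.1) (z : Space n) v⟫ = 0 := by
  obtain ⟨w, rfl⟩ := mem_range_inclDeriv.mpr hv
  have hi : ⟪(z : Space n), -(I • inclDeriv z w)⟫ = 0 := by
    rw [inner_neg_right, ← real_inner_I_smul_left, hv']
  obtain ⟨u, hu⟩ := mem_range_inclDeriv.mpr hi
  have hw : w ∈ contactPlane z := mem_contactPlane.mpr ⟨u, by
    rw [hu, smul_neg, smul_smul, I_mul_I, neg_one_smul, neg_neg]⟩
  have h := φ.2 z
  have hm : mfderiv (𝓡 (2 * n + 1)) (𝓡 (2 * n + 1)) φ.1 z w ∈ contactPlane (φ.1 z) := by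
    rw [← h]
    exact ⟨w, hw, rfl⟩
  obtain ⟨y, hy⟩ := mem_contactPlane.mp hm
  rw [fderiv_radialExt_inclDeriv, ← hy, real_inner_I_smul_I_smul]
  exact mem_range_inclDeriv.mp ⟨y, rfl⟩

/-- The factor by which the contact form at `φ z` pulls back to the contact form at `z`. -/
def conformalFactor (φ : Cont n) (z : Sphere n) : ℝ :=
  ⟪I • (φ.1 z : Space n), fderiv ℝ (radialExt φ.1) (z : Space n) (I • (z : Space n))⟫

/-- The pullback of the contact form agrees with a multiple of it on the radial direction, on the
Reeb direction `i z` and on the contact hyperplane. -/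
lemma contact_form_fderiv (φ : Cont n) (z : Sphere n) (w : Space n) :
    ⟪I • (φ.1 z : Space n), fderiv ℝ (radialExt φ.1) (z : Space n) w⟫ =
      conformalFactor φ z * ⟪I • (z : Space n), w⟫ := by
  have hn : ‖(z : Space n)‖ = 1 := mem_sphere_zero_iff_norm.mp z.2
  set a : ℝ := ⟪(z : Space n), w⟫ with ha
  set b : ℝ := ⟪I • (z : Space n), w⟫ with hb
  have hzz : ⟪(z : Space n), (z : Space n)⟫ = 1 := by rw [real_inner_self_eq_norm_sq, hn]; norm_num
  have hii : ⟪I • (z : Space n), I • (z : Space n)⟫ = 1 := by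
    rw [real_inner_I_smul_I_smul, hzz]
  have hiz := real_inner_I_smul_self (z : Space n)
  have hzi : ⟪(z : Space n), I • (z : Space n)⟫ = 0 := by rw [real_inner_comm, hiz]
  have h0 := contact_form_fderiv_eq_zero φ z (v := w - a • (z : Space n) - b • I • (z : Space n))
    (by rw [inner_sub_right, inner_sub_right, inner_smul_right, inner_smul_right, hzz, hzi]
        simp [ha])
    (by rw [inner_sub_right, inner_sub_right, inner_smul_right, inner_smul_right, hii, hiz]
        simp [hb])
  rw [map_sub, map_sub, map_smul, map_smul, fderiv_radialExt_self, inner_sub_right,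
    inner_sub_right, inner_smul_right, inner_smul_right, inner_zero_right] at h0
  rw [conformalFactor]
  linarith

/-- If the conformal factor vanished, the differential would map the tangent space at `z` into the
contact hyperplane at `φ z`, contrary to its surjectivity. -/
lemma conformalFactor_ne_zero (φ : Cont n) (z : Sphere n) : conformalFactor φ z ≠ 0 := by
  intro h0
  obtain ⟨w, hw⟩ := mem_range_inclDeriv.mpr
    (show ⟪(φ.1 z : Space n), I • (φ.1 z : Space n)⟫ = 0 by
      rw [real_inner_comm, real_inner_I_smul_self])
  obtain ⟨u, rfl⟩ := (φ.1.mfderivToContinuousLinearEquiv (by simp) z).surjective w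
  have h1 := contact_form_fderiv φ z (inclDeriv z u)
  rw [h0, zero_mul, fderiv_radialExt_inclDeriv] at h1
  have h2 : inclDeriv (φ.1 z) (mfderiv (𝓡 (2 * n + 1)) (𝓡 (2 * n + 1)) φ.1 z u) =
    I • (φ.1 z : Space n) := hw
  rw [h2, inner_self_eq_zero] at h1
  exact ne_zero_of_mem_unit_sphere (φ.1 z) ((smul_eq_zero.mp h1).resolve_left I_ne_zero)

/-- The radial extension pulls the contact form back to a multiple of itself away from the origin,
not only along the sphere: its derivative is homogeneous of degree `-1`. This form of the identity
can be differentiated in all directions. -/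
lemma contact_form_fderiv_of_ne_zero (φ : Cont n) {x : Space n} (hx : x ≠ 0) (w : Space n) :
    ‖x‖ ^ 2 * ⟪I • radialExt φ.1 x, fderiv ℝ (radialExt φ.1) x w⟫ =
      ⟪I • radialExt φ.1 x, fderiv ℝ (radialExt φ.1) x (I • x)⟫ * ⟪I • x, w⟫ := by
  have hx0 : ‖x‖ ≠ 0 := norm_ne_zero_iff.mpr hx
  have hc : 0 < ‖x‖ := norm_pos_iff.mpr hx
  obtain ⟨z, hz⟩ : ∃ z : Sphere n, x = ‖x‖ • (z : Space n) :=
    ⟨⟨‖x‖⁻¹ • x, by rw [mem_sphere_zero_iff_norm, norm_smul, norm_inv, norm_norm,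
      inv_mul_cancel₀ hx0]⟩, by simp [smul_smul, hx0]⟩
  generalize ‖x‖ = c at *
  subst hz
  have hd : fderiv ℝ (radialExt φ.1) (z : Space n) =
      c • fderiv ℝ (radialExt φ.1) (c • (z : Space n)) := by
    rw [← fderiv_comp_smul]
    congr 1
    funext y
    exact (radialExt_smul _ hc y).symm
  have h1 := contact_form_fderiv φ z w
  rw [conformalFactor, hd] at h1
  rw [radialExt_smul _ hc, radialExt_coe, smul_comm I c, map_smul]
  simp only [smul_apply, inner_smul_right, inner_smul_left] at h1 ⊢
  have h2 := mul_left_cancel₀ hx0 (h1.trans (mul_assoc _ _ _))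
  rw [h2]
  simp only [conj_trivial]
  ring

/-- On the contact hyperplanes a contactomorphism is conformally symplectic. -/
lemma symplectic_form_fderiv (φ : Cont n) (z : Sphere n) {v w : Space n}
    (hv : inner ℂ (z : Space n) v = 0) (hw : inner ℂ (z : Space n) w = 0) :
    ⟪I • fderiv ℝ (radialExt φ.1) (z : Space n) v, fderiv ℝ (radialExt φ.1) (z : Space n) w⟫ =
      conformalFactor φ z * ⟪I • v, w⟫ := by
  have hz : (z : Space n) ≠ 0 := ne_zero_of_mem_unit_sphere z
  have h := conformal_symplectic (F := radialExt φ.1) (z := (z : Space n)) (v := v) (w := w)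
    ((contDiffAt_radialExt φ hz).of_le (by norm_cast))
    (mem_sphere_zero_iff_norm.mp z.2)
    (by filter_upwards [isOpen_ne.mem_nhds hz] with x hx
        exact contact_form_fderiv_of_ne_zero φ hx)
    (by simp [real_inner_eq_re, hv])
    (by simp [real_inner_eq_re, hv])
    (by simp [real_inner_eq_re, hw])
    (by simp [real_inner_eq_re, hw])
  rw [h, radialExt_coe]
  rfl

lemma continuous_iteratedFDeriv_radialExt (k : ℕ) (z : Sphere n) (m : Fin k → Space n) :
    Continuous fun φ : Cont n => iteratedFDeriv ℝ k (radialExt φ.1) (z : Space n) m := by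
  have h1 : Continuous (jet (n := n) k) :=
    continuous_iff_le_induced.mpr (iInf_le _ k)
  have h2 : Continuous fun φ : Cont n => iteratedFDeriv ℝ k (radialExt φ.1) (z : Space n) :=
    (UniformFun.uniformContinuous_eval _ z).continuous.comp h1
  exact (ContinuousMultilinearMap.apply ℝ (fun _ : Fin k => Space n) (Space n) m).continuous.comp h2

lemma continuous_fderiv_radialExt (z : Sphere n) (v : Space n) :
    Continuous fun φ : Cont n => fderiv ℝ (radialExt φ.1) (z : Space n) v :=
  (continuous_iteratedFDeriv_radialExt 1 z fun _ => v).congr fun _ => iteratedFDeriv_one_apply _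

lemma continuous_apply (z : Sphere n) : Continuous fun φ : Cont n => (φ.1 z : Space n) :=
  (continuous_iteratedFDeriv_radialExt 0 z 0).congr fun _ =>
    (iteratedFDeriv_zero_apply _).trans (radialExt_coe _ z)

lemma continuous_conformalFactor (z : Sphere n) :
    Continuous fun φ : Cont n => conformalFactor φ z :=
  ((continuous_apply z).const_smul I).inner (continuous_fderiv_radialExt z _)

lemma fderiv_radialExt_inclusion (A : Matrix.unitaryGroup (Fin (n + 1)) ℂ) (z : Sphere n)
    {v : Space n} (hv : ⟪(z : Space n), v⟫ = 0) :
    fderiv ℝ (radialExt (inclusion n A).1) (z : Space n) v = unitaryLin A v := by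
  obtain ⟨w, rfl⟩ := mem_range_inclDeriv.mpr hv
  rw [fderiv_radialExt_inclDeriv]
  exact inclDeriv_unitary A z w

lemma conformalFactor_inclusion (A : Matrix.unitaryGroup (Fin (n + 1)) ℂ) (z : Sphere n) :
    conformalFactor (inclusion n A) z = 1 := by
  rw [conformalFactor, fderiv_radialExt_inclusion A z (by
    rw [real_inner_comm, real_inner_I_smul_self])]
  change ⟪I • unitaryLin A z, unitaryLin A (I • (z : Space n))⟫ = 1
  rw [map_smul, real_inner_self_eq_norm_sq, norm_smul, norm_unitaryLin,
    mem_sphere_zero_iff_norm.mp z.2]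
  simp

end RadialExt

/-! ### The unitary frame of a contactomorphism at a point -/

section Frame

variable {n : ℕ}

local notation "⟪" x ", " y "⟫" => inner ℝ x y

/-- The complex linear part `v ↦ (D v - i D (i v)) / 2` of a real linear map `D`. -/
def complexPart (D : Space n →L[ℝ] Space n) : Space n →ₗ[ℂ] Space n where
  toFun v := (1 / 2 : ℂ) • (D v - I • D (I • v))
  map_add' v w := by
    simp only [smul_add, map_add]
    module
  map_smul' c v := by
    have hc : ∀ u : Space n, c • u = c.re • u + c.im • I • u := fun u => by
      conv_lhs => rw [← re_add_im c, add_smul, mul_smul]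
      simp
    have h1 : D (c • v) = c.re • D v + c.im • D (I • v) := by
      rw [hc, map_add, map_smul, map_smul]
    have h2 : D (I • c • v) = c.re • D (I • v) - c.im • D v := by
      have h : I • c • v = c.re • I • v - c.im • v := by
        rw [hc, smul_add, smul_comm I c.re, smul_comm I c.im, smul_smul I I v, I_mul_I,
          neg_one_smul, smul_neg, sub_eq_add_neg]
      rw [h, map_sub, D.map_smul c.re, D.map_smul c.im]
    rw [h1, h2, RingHom.id_apply, hc ((1 / 2 : ℂ) • (D v - I • D (I • v)))]
    simp only [← coe_smul]
    match_scalars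
    · ring
    · linear_combination (c.im / 2 : ℂ) * I_mul_I

lemma complexPart_apply (D : Space n →L[ℝ] Space n) (v : Space n) :
    complexPart D v = (1 / 2 : ℂ) • (D v - I • D (I • v)) := rfl

/-- The base point `(1, 0, …, 0)` of the sphere. -/
def basePoint (n : ℕ) : Sphere n :=
  ⟨EuclideanSpace.single 0 1, by rw [mem_sphere_zero_iff_norm]; simp⟩

lemma inner_basePoint (v : Space n) : inner ℂ (basePoint n : Space n) v = v 0 := by
  simp [basePoint, EuclideanSpace.inner_single_left]

/-- The complex linear map sending the base point `z` to `φ z` and equal on the contact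
hyperplane at `z` to the complex linear part of the differential of `φ`. -/
def frameMap (φ : Cont n) : Space n →ₗ[ℂ] Space n :=
  let z := basePoint n
  ((innerSL ℂ (z : Space n)).toLinearMap).smulRight (φ.1 z : Space n) +
    complexPart (fderiv ℝ (radialExt φ.1) (z : Space n)) ∘ₗ
      (LinearMap.id - ((innerSL ℂ (z : Space n)).toLinearMap).smulRight (z : Space n))

lemma frameMap_apply (φ : Cont n) (v : Space n) :
    frameMap φ v = v 0 • (φ.1 (basePoint n) : Space n) +
      complexPart (fderiv ℝ (radialExt φ.1) (basePoint n : Space n))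
        (v - v 0 • (basePoint n : Space n)) := by
  simp [frameMap, inner_basePoint]

lemma continuous_frameMap (v : Space n) : Continuous fun φ : Cont n => frameMap φ v := by
  simp only [frameMap_apply, complexPart_apply]
  exact ((continuous_apply _).const_smul (v 0)).add <| ((continuous_fderiv_radialExt _ _).sub
    ((continuous_fderiv_radialExt _ _).const_smul I)).const_smul (1 / 2 : ℂ)

/-- A linear conformally symplectic map with positive factor has invertible complex linear part:
on the kernel of that part `D v = i D (i v)`, so `⟪i D v, D (i v)⟫ ≤ 0`, whereas it is a positive
multiple of `‖v‖ ^ 2`. -/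
lemma frameMap_injective {φ : Cont n} (hφ : 0 < conformalFactor φ (basePoint n)) :
    Function.Injective (frameMap φ) := by
  refine (injective_iff_map_eq_zero _).mpr fun v hv => ?_
  rw [frameMap_apply] at hv
  set z := basePoint n with hz
  set D := fderiv ℝ (radialExt φ.1) (z : Space n) with hD
  set u : Space n := v - v 0 • (z : Space n) with hu
  have hn : ‖(z : Space n)‖ = 1 := mem_sphere_zero_iff_norm.mp z.2
  have hzu : inner ℂ (z : Space n) u = 0 := by
    rw [hu, inner_sub_right, inner_smul_right, inner_basePoint, inner_self_eq_norm_sq_to_K, hn]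
    simp
  have hziu : inner ℂ (z : Space n) (I • u) = 0 := by rw [inner_smul_right, hzu, mul_zero]
  -- The image of the contact hyperplane is complex orthogonal to `φ z`.
  have hperp : ∀ w, inner ℂ (z : Space n) w = 0 → inner ℂ (φ.1 z : Space n) (D w) = 0 := by
    intro w hw
    have h1 := inner_fderiv_radialExt φ z w
    have h2 := contact_form_fderiv_eq_zero φ z (v := w) (by simp [real_inner_eq_re, hw])
      (by simp [real_inner_eq_re, hw])
    rw [real_inner_eq_re] at h1 h2
    rw [inner_smul_left] at h2
    refine Complex.ext h1 ?_
    simpa using h2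
  have h1 : v 0 = 0 := by
    have h2 := congrArg (inner ℂ (φ.1 z : Space n)) hv
    rw [complexPart_apply, inner_add_right, inner_smul_right, inner_smul_right, inner_sub_right,
      inner_smul_right, hperp u hzu, hperp _ hziu, inner_self_eq_norm_sq_to_K,
      mem_sphere_zero_iff_norm.mp (φ.1 z).2] at h2
    simpa using h2
  rw [h1, zero_smul, zero_add, complexPart_apply] at hv
  have h2 : D u = I • D (I • u) := sub_eq_zero.mp ((smul_eq_zero.mp hv).resolve_left (by norm_num))
  have h3 := symplectic_form_fderiv φ z hzu hziu
  rw [← hD, real_inner_I_smul_I_smul, h2, smul_smul, I_mul_I, neg_one_smul, inner_neg_left,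
    real_inner_self_eq_norm_sq, real_inner_self_eq_norm_sq] at h3
  have h4 : ‖u‖ ^ 2 = 0 := by
    nlinarith [sq_nonneg ‖D (I • u)‖, sq_nonneg ‖u‖]
  have h5 : u = 0 := norm_eq_zero.mp (pow_eq_zero_iff two_ne_zero |>.mp h4)
  rwa [hu, h1, zero_smul, sub_zero] at h5

lemma frameMap_inclusion (A : Matrix.unitaryGroup (Fin (n + 1)) ℂ) (v : Space n) :
    frameMap (inclusion n A) v = unitaryLin A v := by
  have hn : ‖(basePoint n : Space n)‖ = 1 := mem_sphere_zero_iff_norm.mp (basePoint n).2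
  have hperp : inner ℂ (basePoint n : Space n) (v - v 0 • (basePoint n : Space n)) = 0 := by
    rw [inner_sub_right, inner_smul_right, inner_basePoint, inner_self_eq_norm_sq_to_K, hn]
    simp
  rw [frameMap_apply, complexPart_apply,
    fderiv_radialExt_inclusion A _ (by rw [real_inner_eq_re, hperp, zero_re]),
    fderiv_radialExt_inclusion A _ (by rw [real_inner_eq_re, inner_smul_right, hperp]; simp)]
  change v 0 • unitaryLin A (basePoint n : Space n) + _ = _
  simp only [map_sub, map_smul, smul_sub, smul_smul I I, I_mul_I]
  module

/-- The image of the standard basis under `frameMap`. Contactomorphisms that reverse the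
coorientation at the base point, for which `frameMap` may degenerate, form a clopen set and are
given the standard basis instead. -/
def frame (φ : Cont n) (k : Fin (n + 1)) : Space n :=
  open Classical in
  if 0 < conformalFactor φ (basePoint n) then frameMap φ (EuclideanSpace.single k 1)
  else EuclideanSpace.single k 1

lemma continuous_frame (k : Fin (n + 1)) : Continuous fun φ : Cont n => frame φ k := by
  have hc := continuous_conformalFactor (basePoint n)
  have hcl : IsClopen {φ : Cont n | 0 < conformalFactor φ (basePoint n)} := by
    refine ⟨?_, isOpen_lt continuous_const hc⟩
    have : {φ : Cont n | 0 < conformalFactor φ (basePoint n)} =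
        {φ : Cont n | 0 ≤ conformalFactor φ (basePoint n)} := by
      ext φ
      exact (conformalFactor_ne_zero φ _).symm.le_iff_lt.symm
    rw [this]
    exact isClosed_le continuous_const hc
  unfold frame
  refine continuous_if (fun φ hφ => ?_) (continuous_frameMap _).continuousOn continuousOn_const
  rw [hcl.frontier_eq] at hφ
  exact hφ.elim

lemma linearIndependent_frame (φ : Cont n) : LinearIndependent ℂ (frame φ) := by
  have hs : LinearIndependent ℂ fun k : Fin (n + 1) => (EuclideanSpace.single k 1 : Space n) := by
    have h := (EuclideanSpace.basisFun (Fin (n + 1)) ℂ).orthonormal.linearIndependent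
    rwa [show ⇑(EuclideanSpace.basisFun (Fin (n + 1)) ℂ) = fun k => EuclideanSpace.single k 1 from
      funext fun k => EuclideanSpace.basisFun_apply _ _ k] at h
  by_cases h : 0 < conformalFactor φ (basePoint n)
  · have h1 := hs.map' (frameMap φ) (LinearMap.ker_eq_bot.mpr (frameMap_injective h))
    rwa [show frame φ = frameMap φ ∘ fun k => EuclideanSpace.single k 1 from
      funext fun k => if_pos h]
  · rwa [show frame φ = fun k => EuclideanSpace.single k 1 from funext fun k => if_neg h]

lemma frame_inclusion (A : Matrix.unitaryGroup (Fin (n + 1)) ℂ) (k : Fin (n + 1)) :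
    frame (inclusion n A) k = unitaryLin A (EuclideanSpace.single k 1) := by
  simp [frame, conformalFactor_inclusion, frameMap_inclusion]

/-- The unitary matrix whose columns are the Gram-Schmidt orthonormalization of the frame of a
contactomorphism: a retraction of the contactomorphism group onto the unitary group. -/
def unitaryFrame (φ : Cont n) : Matrix.unitaryGroup (Fin (n + 1)) ℂ :=
  ⟨Matrix.of fun i k => InnerProductSpace.gramSchmidtNormed ℂ (frame φ) k i, by
    rw [Matrix.mem_unitaryGroup_iff']
    ext i k
    have h := orthonormal_iff_ite.mp
      (InnerProductSpace.gramSchmidtNormed_orthonormal (linearIndependent_frame φ)) i k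
    rw [PiLp.inner_apply] at h
    rw [Matrix.mul_apply, Matrix.one_apply, ← h]
    simp [Matrix.star_apply, mul_comm]⟩

lemma continuous_unitaryFrame : Continuous (unitaryFrame (n := n)) := by
  refine Continuous.subtype_mk (continuous_matrix fun i k => ?_) _
  exact (EuclideanSpace.proj (𝕜 := ℂ) i).continuous.comp
    (continuous_gramSchmidtNormed continuous_frame linearIndependent_frame k)

lemma unitaryFrame_inclusion (A : Matrix.unitaryGroup (Fin (n + 1)) ℂ) :
    unitaryFrame (inclusion n A) = A := by
  have hA : Orthonormal ℂ (frame (inclusion n A)) := by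
    let L : Space n →ₗᵢ[ℂ] Space n := ⟨(unitaryLin A).toLinearMap, norm_unitaryLin A⟩
    have h := (EuclideanSpace.basisFun (Fin (n + 1)) ℂ).orthonormal.comp_linearIsometry L
    convert h using 1
    funext k
    simp [frame_inclusion, L]
  refine Subtype.ext (Matrix.ext fun i k => ?_)
  simp [unitaryFrame, gramSchmidtNormed_of_orthonormal hA, frame_inclusion, unitaryLin]

end Frame

/-! ### Left inverses and homotopy groups -/

lemma homotopyMap_injective_of_leftInverse {X Y : Type*} [TopologicalSpace X] [TopologicalSpace Y]
    (j : ℕ) (f : C(X, Y)) (g : C(Y, X)) (hgf : Function.LeftInverse g f) (x : X) (y : Y)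
    (h : f x = y) : Function.Injective (homotopyMap j f x y h) := by
  have hg : g y = x := h ▸ hgf x
  refine Function.LeftInverse.injective (g := homotopyMap j g y x hg) fun a => ?_
  induction a using Quotient.inductionOn with
  | h γ => exact congrArg _ (Subtype.ext (ContinuousMap.ext fun t => hgf (γ.1 t)))

end ContactSphere

end

/-- For `j ≤ 2n+1` the inclusion `ι : U(n+1) → Cont(S^(2n+1), ξ₀)` is injective on `π_j`. -/
theorem theorem1 (n j : ℕ) (hj : j ≤ 2 * n + 1) :
    Function.Injective
      (ContactSphere.homotopyMap j
        (⟨ContactSphere.inclusion n, ContactSphere.continuous_inclusion n⟩ :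
          C(Matrix.unitaryGroup (Fin (n + 1)) ℂ, ContactSphere.Cont n))
        1 1 (map_one (ContactSphere.inclusion n))) := by
  refine ContactSphere.homotopyMap_injective_of_leftInverse j
    ⟨ContactSphere.inclusion n, ContactSphere.continuous_inclusion n⟩
    ⟨ContactSphere.unitaryFrame, ContactSphere.continuous_unitaryFrame⟩ (fun A => ?_) 1 1
    (map_one (ContactSphere.inclusion n))
  exact ContactSphere.unitaryFrame_inclusion A
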